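/- All rings and algebras are commutative with $1$. Let $R$ be a ring. An $R$-algebra has rank $n$ if it is finitely generated projective as an $R$-module, of constant rank $n$ at all primes. For an element $a$ of such an algebra let $P_a(X)\in R[X]$ be the characteristic polynomial of multiplication by $a$, i.e. the determinant of $X-a$. Let $A$ be an $R$-algebra of rank $n$ and $S$ a finite set. Let $B$ be an $R$-algebra with $R$-algebra maps $\beta_s\colon A\to B$ $(s\in S)$. Say that $(B,(\beta_s))$ satisfies $(*)$ if for every $R$-algebra $R'$ and every $a\in A\otimes_R R'$ the polynomial $\prod_{s\in S}\bigl(X-(\beta_s\otimes\mathrm{Id})(a)\bigr)$ divides $P_a(X)$ in $(B\otimes_R R')[X]$. An $S$-closure of $A$ is a pair $(A^{(S)},(\alpha_s)_{s\in S})$ satisfying $(*)$ such that for every $(B,(\beta_s))$ satisfying $(*)$ there is a unique $R$-algebra map $\varphi\colon A^{(S)}\to B$ with $\varphi\circ\alpha_s=\beta_s$ for all $s\in S$. **Theorem (product formula).** Let $m$ be a positive integer. For $i=1,\dots,m$ let $A_i$ be an $R$-algebra of rank $n_i$, and let $A=A_1\times\cdots\times A_m$; this is an $R$-algebra of rank $n=\sum_i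 n_i$. Let $S$ be a finite set and let $\mathscr F$ be the set of all maps $S\to\{1,\dots,m\}$. For $F\in\mathscr F$ and $i\in\{1,\dots,m\}$ an $F^{-1}(i)$-closure $A_i^{(F^{-1}(i))}$ of $A_i$ exists; choose any one, with maps $\alpha_{s,i}\colon A_i\to A_i^{(F^{-1}(i))}$ for $s\in F^{-1}(i)$. Put $$A^{(F)}=\bigotimes_{i=1}^m A_i^{(F^{-1}(i))},\qquad C=\prod_{F\in\mathscr F}A^{(F)},$$ where the tensor product is over $R$, and define $R$-algebra maps $\delta_s\colon A\to C$ for $s\in S$ by $$(\delta_s(a_1,\dots,a_m))_F=1\otimes\cdots\otimes\alpha_{s,i}(a_i)\otimes\cdots\otimes 1,\qquad i=F(s),$$ with $\alpha_{s,i}(a_i)$ in the $i$-th factor. Then $(C,(\delta_s)_{s\in S})$ is an $S$-closure of $A$. -/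

import Mathlib

universe u v w

open scoped TensorProduct Polynomial

noncomputable section

namespace SClosure

section LinearAlgebra

variable (R : Type*) [CommRing R] (M : Type*) [AddCommGroup M] [Module R M]
  [Module.Finite R M] [Module.Projective R M]

/-- The exterior powers of a finitely generated projective module are projective. -/
instance exteriorPower_projective (k : ℕ) : Module.Projective R (⋀[R]^k M) := by
  obtain ⟨l, f, g, -, -, h⟩ := Module.Finite.exists_comp_eq_id_of_projective R M
  refine Module.Projective.of_split (exteriorPower.map k g) (exteriorPower.map k f) ?_
  rw [← exteriorPower.map_comp, h, exteriorPower.map_id]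

variable {M}

/-- The trace of an endomorphism of a finitely generated projective module: the composite of
the inverse of the isomorphism `M^∨ ⊗ M ≃ End M` with the evaluation `M^∨ ⊗ M → R`. -/
def projTrace (f : M →ₗ[R] M) : R :=
  contractLeft R M ((dualTensorHomEquiv R M M).symm f)

/-- The determinant of an endomorphism of a projective module of rank `n`: the trace of the
endomorphism induced on the `n`-th exterior power. -/
def projDet (n : ℕ) (f : M →ₗ[R] M) : R :=
  projTrace R (exteriorPower.map n f)

/-- The characteristic polynomial of an endomorphism `f` of a projective module `M` of rank `n`:
the determinant of `X - f` on the `R[X]`-module `R[X] ⊗ M`. -/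
def projCharpoly (n : ℕ) (f : M →ₗ[R] M) : R[X] :=
  projDet R[X] n ((Polynomial.X : R[X]) • (LinearMap.id : R[X] ⊗[R] M →ₗ[R[X]] R[X] ⊗[R] M) -
    f.baseChange R[X])

end LinearAlgebra

/-- A finite product of projective modules is projective. -/
instance pi_projective {R : Type*} [CommRing R] {ι : Type*} [Finite ι] (M : ι → Type*)
    [∀ i, AddCommGroup (M i)] [∀ i, Module R (M i)] [∀ i, Module.Projective R (M i)] :
    Module.Projective R (∀ i, M i) := by
  classical
  cases nonempty_fintype ι
  exact Module.Projective.of_equiv (DFinsupp.linearEquivFunOnFintype (R := R) (M := M))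

section Closure

variable (R : Type u) [CommRing R]

/-- The characteristic polynomial `P_a` of an element `a` of an `R`-algebra of rank `n`. -/
def algCharpoly (n : ℕ) {A : Type v} [CommRing A] [Algebra R A]
    [Module.Finite R A] [Module.Projective R A] (a : A) : R[X] :=
  projCharpoly R n (LinearMap.mulLeft R a)

/-- `A` is an `R`-algebra of rank `n` and `β s : A → B`, `s : S`, are maps of `R`-algebras.
The condition is that for every `R → R'` and every `a` in `R' ⊗ A` the polynomial
`∏ s, (X - (id ⊗ β s) a)` divides `P_a` in `(R' ⊗ B)[X]`. -/
def CharpolyDivisible (n : ℕ) (A : Type v) [CommRing A] [Algebra R A]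
    [Module.Finite R A] [Module.Projective R A] (S : Type w) [Fintype S]
    (B : Type (max u v w)) [CommRing B] [Algebra R B] (β : S → A →ₐ[R] B) : Prop :=
  ∀ (R' : Type (max u v w)) [CommRing R'] [Algebra R R'] (a : R' ⊗[R] A),
    ∏ s, (Polynomial.X -
        Polynomial.C (Algebra.TensorProduct.map (AlgHom.id R' R') (β s) a)) ∣
      (algCharpoly R' n a).map (algebraMap R' (R' ⊗[R] B))

/-- `(C, α)` is an `S`-closure of the `R`-algebra `A` of rank `n`: it satisfies the divisibility
condition, and it is universal among the `R`-algebras with maps from `A` which satisfy it. -/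
structure IsSClosure (n : ℕ) (A : Type v) [CommRing A] [Algebra R A]
    [Module.Finite R A] [Module.Projective R A] (S : Type w) [Fintype S]
    (C : Type (max u v w)) [CommRing C] [Algebra R C] (α : S → A →ₐ[R] C) : Prop where
  divisible : CharpolyDivisible.{u, v, w} R n A S C α
  universal : ∀ (B : Type (max u v w)) [CommRing B] [Algebra R B] (β : S → A →ₐ[R] B),
    CharpolyDivisible.{u, v, w} R n A S B β → ∃! φ : C →ₐ[R] B, ∀ s, φ.comp (α s) = β s

end Closure

section Product

variable {R : Type*} [CommRing R] {m : ℕ} {A : Fin m → Type*} [∀ i, CommRing (A i)]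
  [∀ i, Algebra R (A i)] {S : Type*} {E : (S → Fin m) → Fin m → Type*}
  [∀ F i, CommRing (E F i)] [∀ F i, Algebra R (E F i)]

/-- The map `δ_s : ∏ i, A i → ∏ F, ⨂ i, E F i` whose component at `F` sends `a` to the pure tensor
with entry `α_{s,i} (a i)` at `i = F s` and entries `1` elsewhere. Here `α F i` is the family of
maps `A i → E F i` indexed by the fibre of `F` over `i`. -/
def productMap (α : ∀ (F : S → Fin m) (i : Fin m), {s : S // F s = i} → A i →ₐ[R] E F i) (s : S) :
    (∀ i, A i) →ₐ[R] (∀ F : S → Fin m, ⨂[R] i, E F i) :=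
  AlgHom.pi fun F ↦
    ((PiTensorProduct.singleAlgHom (F s)).comp (α F (F s) ⟨s, rfl⟩)).comp
      (Pi.evalAlgHom R A (F s))

end Product

end SClosure

end

/-!
# The product formula for `S`-closures

*Characteristic polynomials.* A finite projective module `M` is a retract of a free module `L`, by
maps `i : M → L` and `p : L → M` with `p ∘ i = id`. By cyclicity of the trace
(`projTrace_comp_comm`), the trace of the `n`-th exterior power of `f` is the sum of the principal
`n`-minors of the matrix of `i ∘ f ∘ p` (`projDet_of_retract`). Hence characteristic polynomials
commute with base change (`algCharpoly_map`). Over a local ring they are the usual ones, so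
localizing at the maximal ideals shows that they are multiplicative in finite products
(`algCharpoly_pi`).

*Existence.* The polynomial `∏ s, (X - β s a)` is monic, so it divides `P_a` if and only if the
remainder vanishes, and remainders commute with ring maps. Every element of `R' ⊗ A` is a
specialization of one element over a polynomial ring over `R`; the coefficients of the
corresponding remainder generate the smallest ideal modulo which the divisibility condition holds
(`exists_ideal_divisible_iff`). The quotient of `⨂ s, A` by this ideal is an `S`-closure
(`exists_isSClosure`).

*The product.* Let `β s : ∏ i, A i → B` satisfy the divisibility condition. For `F : S → Fin m` let
`e F` be the product over `s` of the images under `β s` of the idempotents belonging to `A (F s)`.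
The `e F` are complete orthogonal idempotents, and modulo `1 - e F` every `β s` factors through
`A (F s)`. The divisibility condition then splits into one condition for each `A i` and the fibre
of `F` over `i` (`charpolyDivisible_iff_fibres`), so the closures of the factors map uniquely to
`B ⧸ (1 - e F)`; these maps are assembled along `B ≃ ∏ F, B ⧸ (1 - e F)`
(`isSClosure_productMap`).
-/

noncomputable section

namespace SClosure

/-! ### Traces and determinants of endomorphisms of projective modules -/

section Trace

variable {R : Type*} [CommRing R]

lemma projTrace_dualTensorHom {M : Type*} [AddCommGroup M] [Module R M] [Module.Finite R M]
    [Module.Projective R M] (t : Module.Dual R M ⊗[R] M) :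
    projTrace R (dualTensorHom R M M t) = contractLeft R M t :=
  congrArg (contractLeft R M) ((dualTensorHomEquiv R M M).symm_apply_apply t)

lemma projTrace_comp_comm {M N : Type*} [AddCommGroup M] [Module R M] [Module.Finite R M]
    [Module.Projective R M] [AddCommGroup N] [Module R N] [Module.Finite R N]
    [Module.Projective R N] (g : M →ₗ[R] N) (h : N →ₗ[R] M) :
    projTrace R (h ∘ₗ g) = projTrace R (g ∘ₗ h) := by
  obtain ⟨t, rfl⟩ := (dualTensorHomEquiv R M N).surjective g
  have h₁ : h ∘ₗ dualTensorHomEquiv R M N t =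
      dualTensorHom R M M (h.lTensor (Module.Dual R M) t) :=
    (LinearMap.congr_fun (dualTensorHom_comp_lTensor (M := M) h) t).symm
  have h₂ : dualTensorHomEquiv R M N t ∘ₗ h =
      dualTensorHom R N N (h.dualMap.rTensor N t) :=
    (LinearMap.congr_fun (dualTensorHom_comp_rTensor_dualMap (P := N) h) t).symm
  rw [h₁, h₂, projTrace_dualTensorHom, projTrace_dualTensorHom]
  clear h₁ h₂
  induction t with
  | zero => simp
  | tmul φ n => simp
  | add x y hx hy => simp only [map_add, hx, hy]

lemma projTrace_eq_sum {M ι : Type*} [AddCommGroup M] [Module R M] [Module.Finite R M]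
    [Module.Projective R M] [Fintype ι] (b : Module.Basis ι R M) (f : M →ₗ[R] M) :
    projTrace R f = ∑ i, b.coord i (f (b i)) := by
  have hf : f = dualTensorHom R M M (∑ i, b.coord i ⊗ₜ[R] f (b i)) := by
    ext m
    conv_lhs => rw [← b.sum_repr m]
    simp only [map_sum, map_smul, LinearMap.sum_apply, dualTensorHom_apply,
      Module.Basis.coord_apply]
  conv_lhs => rw [hf]
  rw [projTrace_dualTensorHom]
  simp

/-- The sum of the principal minors of size `n` of a square matrix, that is, the trace of its
`n`-th exterior power. -/
def minorSum {ι : Type*} [LinearOrder ι] [Fintype ι] (n : ℕ) (N : Matrix ι ι R) : R :=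
  ∑ s : Set.powersetCard ι n, (N.submatrix (Set.powersetCard.ofFinEmbEquiv.symm s)
    (Set.powersetCard.ofFinEmbEquiv.symm s)).det

lemma minorSum_map {R' ι : Type*} [CommRing R'] [LinearOrder ι] [Fintype ι] (n : ℕ)
    (N : Matrix ι ι R) (φ : R →+* R') : minorSum n (N.map φ) = φ (minorSum n N) := by
  simp only [minorSum, map_sum, RingHom.map_det]
  rfl

lemma minorSum_self (n : ℕ) (N : Matrix (Fin n) (Fin n) R) : minorSum n N = N.det := by
  have hs : ∀ s : Set.powersetCard (Fin n) n,
      ⇑(Set.powersetCard.ofFinEmbEquiv.symm s) = id := fun s ↦ by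
    have hinj := (Set.powersetCard.ofFinEmbEquiv.symm s).injective
    refine ((Set.powersetCard.ofFinEmbEquiv.symm s).strictMono.range_inj strictMono_id).mp ?_
    rw [(Finite.surjective_of_injective hinj).range_eq, Set.range_id]
  have hc : Fintype.card (Set.powersetCard (Fin n) n) = 1 := by
    rw [Fintype.card_eq_nat_card, Set.powersetCard.card]; simp
  simp only [minorSum, hs, Matrix.submatrix_id_id]
  simp [hc]

lemma projDet_eq_minorSum {M ι : Type*} [AddCommGroup M] [Module R M] [Module.Finite R M]
    [Module.Projective R M] [LinearOrder ι] [Fintype ι] (b : Module.Basis ι R M) (n : ℕ)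
    (f : M →ₗ[R] M) : projDet R n f = minorSum n (LinearMap.toMatrix b b f) := by
  rw [projDet, projTrace_eq_sum (b.exteriorPower n)]
  refine Finset.sum_congr rfl fun s _ ↦ ?_
  rw [exteriorPower.basis_coord, exteriorPower.basis_apply, exteriorPower.map_apply_ιMulti_family,
    exteriorPower.ιMulti_family, exteriorPower.ιMultiDual_apply_ιMulti, ← Matrix.det_transpose]
  congr 1
  ext i j
  simp [LinearMap.toMatrix_apply]

/-- The determinant of an endomorphism of a direct summand of a free module is computed by the
minors of a matrix, by cyclicity of the trace. -/
lemma projDet_of_retract {M L ι : Type*} [AddCommGroup M] [Module R M] [Module.Finite R M]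
    [Module.Projective R M] [AddCommGroup L] [Module R L] [LinearOrder ι] [Fintype ι]
    (b : Module.Basis ι R L) (i : M →ₗ[R] L) (p : L →ₗ[R] M)
    (h : p ∘ₗ i = LinearMap.id) (n : ℕ) (f : M →ₗ[R] M) :
    projDet R n f = minorSum n (LinearMap.toMatrix b b (i ∘ₗ f ∘ₗ p)) := by
  have : Module.Finite R L := Module.Finite.of_basis b
  have : Module.Projective R L := Module.Projective.of_basis b
  rw [← projDet_eq_minorSum, projDet, projDet, exteriorPower.map_comp,
    projTrace_comp_comm, ← exteriorPower.map_comp, LinearMap.comp_assoc, h, LinearMap.comp_id]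

lemma projCharpoly_of_retract {M L ι : Type*} [AddCommGroup M] [Module R M] [Module.Finite R M]
    [Module.Projective R M] [AddCommGroup L] [Module R L] [LinearOrder ι] [Fintype ι]
    (b : Module.Basis ι R L) (i : M →ₗ[R] L) (p : L →ₗ[R] M)
    (h : p ∘ₗ i = LinearMap.id) (n : ℕ) (f : M →ₗ[R] M) :
    projCharpoly R n f = minorSum n
      ((Polynomial.X : R[X]) • (LinearMap.toMatrix b b (i ∘ₗ p)).map Polynomial.C -
        (LinearMap.toMatrix b b (i ∘ₗ f ∘ₗ p)).map Polynomial.C) := by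
  have h' : p.baseChange R[X] ∘ₗ i.baseChange R[X] = LinearMap.id := by
    rw [← LinearMap.baseChange_comp, h, LinearMap.baseChange_id]
  rw [projCharpoly, projDet_of_retract (Algebra.TensorProduct.basis R[X] b) _ _ h',
    LinearMap.sub_comp, LinearMap.comp_sub, LinearMap.smul_comp, LinearMap.comp_smul,
    LinearMap.id_comp, ← LinearMap.baseChange_comp, ← LinearMap.baseChange_comp,
    ← LinearMap.baseChange_comp]
  refine congrArg (minorSum n) ((map_sub (LinearMap.toMatrix (Algebra.TensorProduct.basis R[X] b)
    (Algebra.TensorProduct.basis R[X] b)) _ _).trans ?_)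
  rw [map_smul, LinearMap.toMatrix_baseChange, LinearMap.toMatrix_baseChange]
  rfl

lemma projCharpoly_of_basis {M : Type*} [AddCommGroup M] [Module R M] [Module.Finite R M]
    [Module.Projective R M] {n : ℕ} (b : Module.Basis (Fin n) R M) (f : M →ₗ[R] M) :
    projCharpoly R n f = (LinearMap.toMatrix b b f).charpoly := by
  rw [projCharpoly_of_retract b LinearMap.id LinearMap.id rfl, minorSum_self, Matrix.charpoly,
    Matrix.charmatrix]
  simp [← Matrix.smul_one_eq_diagonal]

lemma projCharpoly_baseChange (R' : Type*) [CommRing R'] [Algebra R R'] {M : Type*}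
    [AddCommGroup M] [Module R M] [Module.Finite R M] [Module.Projective R M] (n : ℕ)
    (f : M →ₗ[R] M) :
    projCharpoly R' n (f.baseChange R') = (projCharpoly R n f).map (algebraMap R R') := by
  obtain ⟨l, p, i, -, -, h⟩ := Module.Finite.exists_comp_eq_id_of_projective R M
  have h' : p.baseChange R' ∘ₗ i.baseChange R' = LinearMap.id := by
    rw [← LinearMap.baseChange_comp, h, LinearMap.baseChange_id]
  rw [projCharpoly_of_retract (Pi.basisFun R (Fin l)) i p h,
    projCharpoly_of_retract (Algebra.TensorProduct.basis R' (Pi.basisFun R (Fin l))) _ _ h',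
    ← Polynomial.coe_mapRingHom, ← minorSum_map, ← LinearMap.baseChange_comp,
    ← LinearMap.baseChange_comp, ← LinearMap.baseChange_comp, LinearMap.toMatrix_baseChange,
    LinearMap.toMatrix_baseChange]
  congr 1
  ext1 a c
  simp

lemma projCharpoly_conj {M N : Type*} [AddCommGroup M] [Module R M] [Module.Finite R M]
    [Module.Projective R M] [AddCommGroup N] [Module R N] [Module.Finite R N]
    [Module.Projective R N] (e : M ≃ₗ[R] N) (n : ℕ) (f : M →ₗ[R] M) :
    projCharpoly R n (e.conj f) = projCharpoly R n f := by
  obtain ⟨l, p, i, -, -, h⟩ := Module.Finite.exists_comp_eq_id_of_projective R M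
  rw [projCharpoly_of_retract (Pi.basisFun R (Fin l)) i p h,
    projCharpoly_of_retract (Pi.basisFun R (Fin l)) (i ∘ₗ e.symm.toLinearMap)
      (e.toLinearMap ∘ₗ p) (by
        ext x; simpa using congrArg e (LinearMap.congr_fun h (e.symm x)))]
  have h₁ : (i ∘ₗ e.symm.toLinearMap) ∘ₗ e.toLinearMap ∘ₗ p = i ∘ₗ p := by ext; simp
  have h₂ : (i ∘ₗ e.symm.toLinearMap) ∘ₗ e.conj f ∘ₗ e.toLinearMap ∘ₗ p = i ∘ₗ f ∘ₗ p := by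
    ext; simp [LinearEquiv.conj_apply]
  rw [h₁, h₂]

end Trace

/-! ### Characteristic polynomials of elements of algebras -/

section AlgCharpoly

variable {R : Type*} [CommRing R]

lemma algCharpoly_algEquiv {A A' : Type*} [CommRing A] [Algebra R A] [Module.Finite R A]
    [Module.Projective R A] [CommRing A'] [Algebra R A'] [Module.Finite R A']
    [Module.Projective R A'] (e : A ≃ₐ[R] A') (n : ℕ) (a : A) :
    algCharpoly R n (e a) = algCharpoly R n a := by
  rw [algCharpoly, algCharpoly, ← projCharpoly_conj e.toLinearEquiv]
  congr 1
  ext x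
  simp [LinearEquiv.conj_apply]

lemma algCharpoly_one_tmul (R' : Type*) [CommRing R'] [Algebra R R'] {A : Type*} [CommRing A]
    [Algebra R A] [Module.Finite R A] [Module.Projective R A] (n : ℕ) (a : A) :
    algCharpoly R' n ((1 : R') ⊗ₜ[R] a) = (algCharpoly R n a).map (algebraMap R R') := by
  rw [algCharpoly, algCharpoly, ← projCharpoly_baseChange]
  congr 1
  ext x
  simp

lemma algCharpoly_map {R' R'' : Type*} [CommRing R'] [Algebra R R'] [CommRing R'']
    [Algebra R R''] (φ : R' →ₐ[R] R'') {A : Type*} [CommRing A] [Algebra R A]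
    [Module.Finite R A] [Module.Projective R A] (n : ℕ) (a : R' ⊗[R] A) :
    algCharpoly R'' n (Algebra.TensorProduct.map φ (AlgHom.id R A) a) =
      (algCharpoly R' n a).map φ.toRingHom := by
  let := φ.toRingHom.toAlgebra
  have : IsScalarTower R R' R'' := IsScalarTower.of_algebraMap_eq' φ.comp_algebraMap.symm
  have h := algCharpoly_one_tmul (R := R') R'' n a
  rw [← algCharpoly_algEquiv (Algebra.TensorProduct.cancelBaseChange R R' R'' R'' A)] at h
  rw [← RingHom.algebraMap_toAlgebra φ.toRingHom, ← h]
  congr 1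
  clear h
  induction a with
  | zero => simp
  | tmul x y =>
    simp only [Algebra.TensorProduct.map_tmul, AlgHom.id_apply,
      Algebra.TensorProduct.cancelBaseChange_tmul, Algebra.smul_def, mul_one]
    rfl
  | add x y hx hy => rw [map_add, TensorProduct.tmul_add, map_add, hx, hy]

lemma algCharpoly_pi_of_basis {m : ℕ} {n : Fin m → ℕ} {A : Fin m → Type*} [∀ i, CommRing (A i)]
    [∀ i, Algebra R (A i)] [∀ i, Module.Finite R (A i)] [∀ i, Module.Projective R (A i)]
    (b : ∀ i, Module.Basis (Fin (n i)) R (A i)) (a : ∀ i, A i) :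
    algCharpoly R (∑ i, n i) a = ∏ i, algCharpoly R (n i) (a i) := by
  let B := Pi.basis b
  have hB : ∀ x y, LinearMap.toMatrix B B (LinearMap.mulLeft R a) x y =
      (b x.1).repr (a x.1 * B y x.1) x.2 := fun x y ↦ by
    simp [LinearMap.toMatrix_apply, B, Pi.basis_repr]
  have htri : (LinearMap.toMatrix B B (LinearMap.mulLeft R a)).BlockTriangular Sigma.fst := by
    intro x y hxy
    rw [hB, Pi.basis_apply, Pi.single_eq_of_ne hxy.ne', mul_zero]
    simp
  simp only [algCharpoly]
  rw [projCharpoly_of_basis (B.reindex finSigmaFinEquiv)]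
  have hr : LinearMap.toMatrix (B.reindex finSigmaFinEquiv) (B.reindex finSigmaFinEquiv)
      (LinearMap.mulLeft R a) = Matrix.reindex finSigmaFinEquiv finSigmaFinEquiv
        (LinearMap.toMatrix B B (LinearMap.mulLeft R a)) := by
    ext x y
    simp [LinearMap.toMatrix_apply, Algebra.leftMulMatrix_eq_repr_mul]
  rw [hr, Matrix.charpoly_reindex, Matrix.charpoly, htri.charmatrix.det_fintype]
  refine Finset.prod_congr rfl fun i _ ↦ ?_
  rw [← Matrix.charmatrix_toSquareBlock, ← Matrix.charpoly, projCharpoly_of_basis (b i),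
    ← Matrix.charpoly_reindex (Equiv.sigmaSubtype i)]
  congr 1
  ext x y
  rw [LinearMap.toMatrix_apply, Matrix.reindex_apply, Matrix.submatrix_apply,
    Matrix.toSquareBlock_def, Matrix.of_apply, hB]
  change (b i).repr (a i * Pi.basis b ⟨i, y⟩ i) x = _
  rw [Pi.basis_apply, Pi.single_eq_same]
  rfl

lemma polynomial_eq_of_localization {P Q : R[X]} (H : ∀ I : MaximalSpectrum R,
    P.map (algebraMap R (Localization.AtPrime I.asIdeal)) =
      Q.map (algebraMap R (Localization.AtPrime I.asIdeal))) : P = Q := by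
  ext d
  refine MaximalSpectrum.toPiLocalization_injective R (funext fun I ↦ ?_)
  simpa [MaximalSpectrum.toPiLocalization_apply_apply] using
    congrArg (Polynomial.coeff · d) (H I)

lemma nonempty_basis_localization {M : Type*} [AddCommGroup M] [Module R M] [Module.Finite R M]
    [Module.Projective R M] {n : ℕ} (hM : ∀ p : PrimeSpectrum R, Module.rankAtStalk M p = n)
    (I : MaximalSpectrum R) :
    Nonempty (Module.Basis (Fin n) (Localization.AtPrime I.asIdeal)
      (Localization.AtPrime I.asIdeal ⊗[R] M)) := by
  let K := Localization.AtPrime I.asIdeal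
  have : Module.Free K (K ⊗[R] M) := Module.free_of_flat_of_isLocalRing
  have h := Module.rankAtStalk_baseChange (R := R) (M := M) (IsLocalRing.closedPoint K)
  rw [hM, Module.rankAtStalk_eq_finrank_of_free] at h
  exact ⟨(Module.finBasis K (K ⊗[R] M)).reindex (finCongr h)⟩

lemma algCharpoly_algebraMap {A : Type*} [CommRing A] [Algebra R A] [Module.Finite R A]
    [Module.Projective R A] {n : ℕ} (hA : ∀ p : PrimeSpectrum R, Module.rankAtStalk A p = n)
    (c : R) : algCharpoly R n (algebraMap R A c) = (Polynomial.X - Polynomial.C c) ^ n := by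
  refine polynomial_eq_of_localization fun I ↦ ?_
  let K := Localization.AtPrime I.asIdeal
  obtain ⟨b⟩ := nonempty_basis_localization hA I
  have hc : (1 : K) ⊗ₜ[R] algebraMap R A c = algebraMap K (K ⊗[R] A) (algebraMap R K c) := by
    rw [Algebra.TensorProduct.algebraMap_apply, Algebra.algebraMap_self_apply,
      Algebra.algebraMap_eq_smul_one, Algebra.algebraMap_eq_smul_one, TensorProduct.tmul_smul,
      TensorProduct.smul_tmul']
  have hm : ∀ k : K, LinearMap.toMatrix b b (LinearMap.mulLeft K (algebraMap K (K ⊗[R] A) k)) =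
      Matrix.diagonal fun _ ↦ k := fun k ↦ by
    ext x y
    rw [LinearMap.toMatrix_apply, LinearMap.mulLeft_apply, ← Algebra.smul_def, map_smul,
      Module.Basis.repr_self]
    simp [Matrix.diagonal_apply, Finsupp.single_apply, eq_comm]
  rw [← algCharpoly_one_tmul, hc, algCharpoly, projCharpoly_of_basis b, hm,
    Matrix.charpoly_diagonal]
  simp [K]

/-- Characteristic polynomials are multiplicative in finite products of algebras of constant rank.
Both sides commute with base change, so this can be checked after localizing at maximal ideals,
where all the algebras are free and the matrix of a multiplication map is block diagonal. -/
lemma algCharpoly_pi {m : ℕ} {n : Fin m → ℕ} {A : Fin m → Type*} [∀ i, CommRing (A i)]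
    [∀ i, Algebra R (A i)] [∀ i, Module.Finite R (A i)] [∀ i, Module.Projective R (A i)]
    (hA : ∀ i (p : PrimeSpectrum R), Module.rankAtStalk (A i) p = n i) (a : ∀ i, A i) :
    algCharpoly R (∑ i, n i) a = ∏ i, algCharpoly R (n i) (a i) := by
  refine polynomial_eq_of_localization fun I ↦ ?_
  let K := Localization.AtPrime I.asIdeal
  rw [Polynomial.map_prod, ← algCharpoly_one_tmul,
    ← algCharpoly_algEquiv (Algebra.TensorProduct.piRight R K K A),
    algCharpoly_pi_of_basis fun i ↦ (nonempty_basis_localization (hA i) I).some,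
    Algebra.TensorProduct.piRight_tmul]
  exact Finset.prod_congr rfl fun i _ ↦ algCharpoly_one_tmul _ _ _

lemma piRight_apply {ι : Type*} [Fintype ι] [DecidableEq ι] {A : ι → Type*} [∀ i, CommRing (A i)]
    [∀ i, Algebra R (A i)] {R' : Type*} [CommRing R'] [Algebra R R'] (a : R' ⊗[R] (∀ i, A i))
    (i : ι) : Algebra.TensorProduct.piRight R R' R' A a i =
      Algebra.TensorProduct.map (AlgHom.id R' R') (Pi.evalAlgHom R A i) a := by
  induction a with
  | zero => simp
  | tmul x y => simp
  | add x y hx hy => rw [map_add, Pi.add_apply, map_add, hx, hy]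

/-- The version of `algCharpoly_pi` after an extension of scalars. -/
lemma algCharpoly_tensor_pi {m : ℕ} {n : Fin m → ℕ} {A : Fin m → Type*} [∀ i, CommRing (A i)]
    [∀ i, Algebra R (A i)] [∀ i, Module.Finite R (A i)] [∀ i, Module.Projective R (A i)]
    (hA : ∀ i (p : PrimeSpectrum R), Module.rankAtStalk (A i) p = n i) {R' : Type*} [CommRing R']
    [Algebra R R'] (a : R' ⊗[R] (∀ i, A i)) :
    algCharpoly R' (∑ i, n i) a = ∏ i, algCharpoly R' (n i)
      (Algebra.TensorProduct.map (AlgHom.id R' R') (Pi.evalAlgHom R A i) a) := by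
  rw [← algCharpoly_algEquiv (Algebra.TensorProduct.piRight R R' R' A), algCharpoly_pi fun i p ↦ by
    rw [Module.rankAtStalk_baseChange, hA]]
  exact Finset.prod_congr rfl fun i _ ↦ congrArg _ (piRight_apply a i)

end AlgCharpoly

/-! ### The ideal of obstructions to divisibility, and existence of closures -/

section Existence

variable {R : Type u} [CommRing R]

/-- The remainder of `P_a` upon division by `∏ s, (X - (id ⊗ β s) a)` in `(R' ⊗ B)[X]`. The divisor
is monic, so unlike divisibility this is compatible with all changes of `R'` and `B`. -/
def divisionRemainder (n : ℕ) {A : Type*} [CommRing A] [Algebra R A] [Module.Finite R A]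
    [Module.Projective R A] {S : Type*} [Fintype S] {B : Type*} [CommRing B] [Algebra R B]
    (β : S → A →ₐ[R] B) {R' : Type*} [CommRing R'] [Algebra R R'] (a : R' ⊗[R] A) :
    (R' ⊗[R] B)[X] :=
  (algCharpoly R' n a).map (algebraMap R' (R' ⊗[R] B)) %ₘ
    ∏ s, (Polynomial.X - Polynomial.C (Algebra.TensorProduct.map (AlgHom.id R' R') (β s) a))

lemma divisionRemainder_eq_zero_iff (n : ℕ) {A : Type*} [CommRing A] [Algebra R A]
    [Module.Finite R A] [Module.Projective R A] {S : Type*} [Fintype S] {B : Type*} [CommRing B]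
    [Algebra R B] (β : S → A →ₐ[R] B) {R' : Type*} [CommRing R'] [Algebra R R']
    (a : R' ⊗[R] A) :
    divisionRemainder n β a = 0 ↔
      ∏ s, (Polynomial.X - Polynomial.C (Algebra.TensorProduct.map (AlgHom.id R' R') (β s) a)) ∣
        (algCharpoly R' n a).map (algebraMap R' (R' ⊗[R] B)) :=
  Polynomial.modByMonic_eq_zero_iff_dvd
    (Polynomial.monic_prod_of_monic _ _ fun _ _ ↦ Polynomial.monic_X_sub_C _)

lemma tensorMap_comp {A : Type*} [CommRing A] [Algebra R A] {B B' : Type*} [CommRing B]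
    [Algebra R B] [CommRing B'] [Algebra R B'] {R' R'' : Type*} [CommRing R'] [Algebra R R']
    [CommRing R''] [Algebra R R''] (β : A →ₐ[R] B) (ψ : R' →ₐ[R] R'') (h : B →ₐ[R] B')
    (a : R' ⊗[R] A) :
    Algebra.TensorProduct.map (AlgHom.id R'' R'') (h.comp β)
        (Algebra.TensorProduct.map ψ (AlgHom.id R A) a) =
      Algebra.TensorProduct.map ψ h (Algebra.TensorProduct.map (AlgHom.id R' R') β a) := by
  induction a with
  | zero => simp
  | tmul x y => simp
  | add x y hx hy => simp only [map_add, hx, hy]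

lemma divisionRemainder_map (n : ℕ) {A : Type*} [CommRing A] [Algebra R A]
    [Module.Finite R A] [Module.Projective R A] {S : Type*} [Fintype S] {B B' : Type*} [CommRing B]
    [Algebra R B] [CommRing B'] [Algebra R B'] (β : S → A →ₐ[R] B) {R' R'' : Type*} [CommRing R']
    [Algebra R R'] [CommRing R''] [Algebra R R''] (ψ : R' →ₐ[R] R'') (h : B →ₐ[R] B')
    (a : R' ⊗[R] A) :
    divisionRemainder n (fun s ↦ h.comp (β s))
        (Algebra.TensorProduct.map ψ (AlgHom.id R A) a) =
      (divisionRemainder n β a).map (Algebra.TensorProduct.map ψ h).toRingHom := by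
  have hc : (algebraMap R'' (R'' ⊗[R] B')).comp ψ.toRingHom =
      (Algebra.TensorProduct.map ψ h).toRingHom.comp (algebraMap R' (R' ⊗[R] B)) := by
    ext x
    simp [Algebra.TensorProduct.algebraMap_apply]
  rw [divisionRemainder, divisionRemainder, Polynomial.map_modByMonic _
    (Polynomial.monic_prod_of_monic _ _ fun _ _ ↦ Polynomial.monic_X_sub_C _), algCharpoly_map,
    Polynomial.map_map, Polynomial.map_map, hc, Polynomial.map_prod]
  congr 1
  refine Finset.prod_congr rfl fun s _ ↦ ?_
  rw [tensorMap_comp, Polynomial.map_sub, Polynomial.map_X, Polynomial.map_C]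
  rfl

/-- The identification of `R[σ] ⊗ B` with `B[σ]`. -/
def mvPolynomialTensorEquiv (R : Type*) [CommRing R] (σ B : Type*) [CommRing B] [Algebra R B] :
    MvPolynomial σ R ⊗[R] B ≃ₐ[R] MvPolynomial σ B :=
  (Algebra.TensorProduct.comm R _ B).trans
    ((MvPolynomial.algebraTensorAlgEquiv R B).restrictScalars R)

lemma mvPolynomialTensorEquiv_map {σ B B' : Type*} [CommRing B] [Algebra R B] [CommRing B']
    [Algebra R B'] (h : B →ₐ[R] B') (x : MvPolynomial σ R ⊗[R] B) :
    mvPolynomialTensorEquiv R σ B'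
        (Algebra.TensorProduct.map (AlgHom.id R (MvPolynomial σ R)) h x) =
      MvPolynomial.map h.toRingHom (mvPolynomialTensorEquiv R σ B x) := by
  induction x with
  | zero => simp
  | tmul p b =>
    simp only [mvPolynomialTensorEquiv, Algebra.TensorProduct.map_tmul, AlgHom.id_apply,
      AlgEquiv.trans_apply, Algebra.TensorProduct.comm_tmul, AlgEquiv.restrictScalars_apply,
      MvPolynomial.algebraTensorAlgEquiv_tmul, MvPolynomial.smul_eq_C_mul, map_mul,
      MvPolynomial.map_C, MvPolynomial.map_map]
    congr 2
    exact congrArg MvPolynomial.map h.comp_algebraMap.symm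
  | add x y hx hy => simp only [map_add, hx, hy]

/-- Over a polynomial ring there is an element of which every element of every `R' ⊗ A` is a
specialization, if `A` is a finite module. -/
lemma exists_generic (R : Type u) [CommRing R] (A : Type v) [CommRing A] [Algebra R A]
    [Module.Finite R A] :
    ∃ (σ : Type w) (g : MvPolynomial σ R ⊗[R] A), ∀ (R' : Type (max u v w)) [CommRing R']
      [Algebra R R'] (a : R' ⊗[R] A), ∃ ψ : MvPolynomial σ R →ₐ[R] R',
        Algebra.TensorProduct.map ψ (AlgHom.id R A) g = a := by
  obtain ⟨k, x, hx⟩ := Module.Finite.exists_fin (R := R) (M := A)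
  refine ⟨ULift (Fin k), ∑ j, MvPolynomial.X ⟨j⟩ ⊗ₜ[R] x j, fun R' _ _ a ↦ ?_⟩
  suffices H : ∃ r : Fin k → R', a = ∑ j, r j ⊗ₜ[R] x j by
    obtain ⟨r, rfl⟩ := H
    exact ⟨MvPolynomial.aeval fun j ↦ r j.down, by simp⟩
  induction a with
  | zero => exact ⟨0, by simp⟩
  | tmul y z =>
    obtain ⟨c, rfl⟩ := (Submodule.mem_span_range_iff_exists_fun R).mp
      (hx ▸ Submodule.mem_top : z ∈ Submodule.span R (Set.range x))
    exact ⟨fun j ↦ c j • y, by simp [TensorProduct.tmul_sum, TensorProduct.smul_tmul]⟩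
  | add y z hy hz =>
    obtain ⟨r, rfl⟩ := hy
    obtain ⟨r', rfl⟩ := hz
    exact ⟨r + r', by simp [TensorProduct.add_tmul, Finset.sum_add_distrib]⟩

/-- For a family of maps `A → B₀` there is a smallest ideal of `B₀` modulo which the divisibility
condition holds: it is generated by the coefficients of the remainder attached to a generic
element of `A`. -/
lemma exists_ideal_divisible_iff (n : ℕ) (A : Type v) [CommRing A] [Algebra R A]
    [Module.Finite R A] [Module.Projective R A] (S : Type w) [Fintype S]
    {B₀ : Type*} [CommRing B₀] [Algebra R B₀] (β₀ : S → A →ₐ[R] B₀) :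
    ∃ I : Ideal B₀, ∀ (B : Type (max u v w)) [CommRing B] [Algebra R B] (h : B₀ →ₐ[R] B),
      CharpolyDivisible.{u, v, w} R n A S B (fun s ↦ h.comp (β₀ s)) ↔ ∀ t ∈ I, h t = 0 := by
  obtain ⟨σ, g, hg⟩ := exists_generic.{u, v, max u v w} R A
  let E := mvPolynomialTensorEquiv R σ B₀
  refine ⟨Ideal.span {t | ∃ d e, MvPolynomial.coeff e (E ((divisionRemainder n β₀ g).coeff d)) = t},
    fun B _ _ h ↦ ?_⟩
  have h₁ : CharpolyDivisible.{u, v, w} R n A S B (fun s ↦ h.comp (β₀ s)) ↔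
      divisionRemainder n (fun s ↦ h.comp (β₀ s)) g = 0 := by
    refine ⟨fun H ↦ (divisionRemainder_eq_zero_iff _ _ _).mpr (H _ g), fun H R' _ _ a ↦ ?_⟩
    obtain ⟨ψ, rfl⟩ := hg R' a
    rw [← divisionRemainder_eq_zero_iff]
    have := divisionRemainder_map n (fun s ↦ h.comp (β₀ s)) ψ (AlgHom.id R B) g
    rw [H, Polynomial.map_zero] at this
    exact this
  have h₂ := divisionRemainder_map n β₀ (AlgHom.id R (MvPolynomial σ R)) h g
  rw [Algebra.TensorProduct.map_id, AlgHom.id_apply] at h₂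
  have h₃ : (∀ t ∈ Ideal.span {t | ∃ d e,
        MvPolynomial.coeff e (E ((divisionRemainder n β₀ g).coeff d)) = t}, h t = 0) ↔
      ∀ d e, h (MvPolynomial.coeff e (E ((divisionRemainder n β₀ g).coeff d))) = 0 := by
    refine ⟨fun H d e ↦ H _ (Ideal.subset_span ⟨d, e, rfl⟩), fun H ↦ ?_⟩
    change _ ≤ RingHom.ker h
    rw [Ideal.span_le]
    rintro _ ⟨d, e, rfl⟩
    exact H d e
  rw [h₁, h₂, h₃, Polynomial.ext_iff]
  refine forall_congr' fun d ↦ ?_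
  rw [Polynomial.coeff_map, Polynomial.coeff_zero,
    ← (mvPolynomialTensorEquiv R σ B).map_eq_zero_iff, MvPolynomial.ext_iff]
  refine forall_congr' fun e ↦ ?_
  rw [MvPolynomial.coeff_zero]
  change MvPolynomial.coeff e (mvPolynomialTensorEquiv R σ B
    (Algebra.TensorProduct.map (AlgHom.id R (MvPolynomial σ R)) h _)) = 0 ↔ _
  rw [mvPolynomialTensorEquiv_map, MvPolynomial.coeff_map]
  rfl

/-- The map out of a finite tensor product of commutative algebras induced by maps on the
factors. -/
def piTensorLift {ι : Type*} [Fintype ι] {A : ι → Type*} [∀ i, CommRing (A i)]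
    [∀ i, Algebra R (A i)] {B : Type*} [CommRing B] [Algebra R B] (f : ∀ i, A i →ₐ[R] B) :
    (⨂[R] i, A i) →ₐ[R] B :=
  PiTensorProduct.liftAlgHom
    ((MultilinearMap.mkPiAlgebra R ι B).compLinearMap fun i ↦ (f i).toLinearMap)
    (by simp) (by simp [Finset.prod_mul_distrib])

lemma piTensorLift_tprod {ι : Type*} [Fintype ι] {A : ι → Type*} [∀ i, CommRing (A i)]
    [∀ i, Algebra R (A i)] {B : Type*} [CommRing B] [Algebra R B] (f : ∀ i, A i →ₐ[R] B)
    (x : ∀ i, A i) : piTensorLift f (PiTensorProduct.tprod R x) = ∏ i, f i (x i) :=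
  PiTensorProduct.lift.tprod x

lemma piTensorLift_comp_single {ι : Type*} [Fintype ι] [DecidableEq ι] {A : ι → Type*}
    [∀ i, CommRing (A i)] [∀ i, Algebra R (A i)] {B : Type*} [CommRing B] [Algebra R B]
    (f : ∀ i, A i →ₐ[R] B) (i : ι) :
    (piTensorLift f).comp (PiTensorProduct.singleAlgHom i) = f i := by
  ext a
  rw [AlgHom.comp_apply, PiTensorProduct.singleAlgHom_apply, piTensorLift_tprod,
    Finset.prod_eq_single i (fun j _ hj ↦ by simp [Pi.mulSingle_eq_of_ne hj]) (by simp)]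
  simp

lemma exists_isSClosure (n : ℕ) (A : Type v) [CommRing A] [Algebra R A]
    [Module.Finite R A] [Module.Projective R A] (S : Type w) [Fintype S] :
    ∃ (E : Type (max u v w)) (_ : CommRing E) (_ : Algebra R E) (α : S → A →ₐ[R] E),
      IsSClosure.{u, v, w} R n A S E α := by
  classical
  obtain ⟨I, hI⟩ := exists_ideal_divisible_iff.{u, v, w} n A S
    (fun s ↦ PiTensorProduct.singleAlgHom (R := R) (A := fun _ : S ↦ A) s)
  refine ⟨(⨂[R] _ : S, A) ⧸ I, inferInstance, inferInstance,
    fun s ↦ (Ideal.Quotient.mkₐ R I).comp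
      (PiTensorProduct.singleAlgHom (R := R) (A := fun _ : S ↦ A) s), ?_, ?_⟩
  · exact (hI _ _).mpr fun t ht ↦ Ideal.Quotient.eq_zero_iff_mem.mpr ht
  · intro B _ _ β hβ
    have hβ' : (fun s ↦ (piTensorLift β).comp
        (PiTensorProduct.singleAlgHom (R := R) (A := fun _ : S ↦ A) s)) = β :=
      funext fun s ↦ piTensorLift_comp_single β s
    refine ⟨Ideal.Quotient.liftₐ I (piTensorLift β) ((hI B _).mp (hβ'.symm ▸ hβ)),
      fun s ↦ ?_, fun φ hφ ↦ ?_⟩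
    · rw [← AlgHom.comp_assoc, Ideal.Quotient.liftₐ_comp]
      exact congrFun hβ' s
    · refine Ideal.Quotient.algHom_ext _ (PiTensorProduct.algHom_ext fun s ↦ ?_)
      rw [Ideal.Quotient.liftₐ_comp, piTensorLift_comp_single, AlgHom.comp_assoc]
      exact hφ s

end Existence

/-! ### The divisibility condition for products -/

section Divisibility

variable {R : Type u} [CommRing R]

lemma CharpolyDivisible.comp {n : ℕ} {A : Type v} [CommRing A] [Algebra R A]
    [Module.Finite R A] [Module.Projective R A] {S : Type w} [Fintype S]
    {B B' : Type (max u v w)} [CommRing B] [Algebra R B] [CommRing B'] [Algebra R B']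
    {β : S → A →ₐ[R] B} (hβ : CharpolyDivisible.{u, v, w} R n A S B β) (h : B →ₐ[R] B') :
    CharpolyDivisible.{u, v, w} R n A S B' (fun s ↦ h.comp (β s)) := by
  intro R' _ _ a
  have := divisionRemainder_map n β (AlgHom.id R R') h a
  rw [Algebra.TensorProduct.map_id, AlgHom.id_apply,
    (divisionRemainder_eq_zero_iff n β a).mpr (hβ R' a), Polynomial.map_zero] at this
  exact (divisionRemainder_eq_zero_iff _ _ _).mp this

lemma charpolyDivisible_pi {n : ℕ} {A : Type v} [CommRing A] [Algebra R A]
    [Module.Finite R A] [Module.Projective R A] {S : Type w} [Fintype S] {ι : Type w} [Finite ι]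
    {B : ι → Type (max u v w)} [∀ i, CommRing (B i)] [∀ i, Algebra R (B i)]
    {β : S → A →ₐ[R] ∀ i, B i}
    (hβ : ∀ i, CharpolyDivisible.{u, v, w} R n A S (B i)
      (fun s ↦ (Pi.evalAlgHom R B i).comp (β s))) :
    CharpolyDivisible.{u, v, w} R n A S (∀ i, B i) β := by
  classical
  cases nonempty_fintype ι
  intro R' _ _ a
  rw [← divisionRemainder_eq_zero_iff]
  ext d
  refine (Algebra.TensorProduct.piRight R R' R' B).injective (funext fun i ↦ ?_)
  have := divisionRemainder_map n β (AlgHom.id R R') (Pi.evalAlgHom R B i) a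
  rw [Algebra.TensorProduct.map_id, AlgHom.id_apply,
    (divisionRemainder_eq_zero_iff _ _ _).mpr (hβ i R' a)] at this
  rw [piRight_apply, Polynomial.coeff_zero, map_zero, Pi.zero_apply]
  have hd := congrArg (Polynomial.coeff · d) this
  simp only [Polynomial.coeff_zero, Polynomial.coeff_map] at hd
  exact hd.symm

variable {m : ℕ} {n : Fin m → ℕ} {A : Fin m → Type v} [∀ i, CommRing (A i)]
  [∀ i, Algebra R (A i)] [∀ i, Module.Finite R (A i)] [∀ i, Module.Projective R (A i)]
  {S : Type w} [Fintype S]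

/-- If each `β s` factors through the factor `A (F s)`, then the divisibility condition for the
product algebra amounts to the conditions for the factors and the fibres of `F`. To pass to the
`i`-th factor, complete an element of `A i` by `0`, or by `1`, in the other factors: this gives
divisibility up to a power of `X`, or of `X - 1`, and these powers are coprime. -/
lemma charpolyDivisible_iff_fibres
    (hA : ∀ i (p : PrimeSpectrum R), Module.rankAtStalk (A i) p = n i) (F : S → Fin m)
    {B : Type (max u v w)} [CommRing B] [Algebra R B]
    (γ : ∀ i, {s : S // F s = i} → A i →ₐ[R] B) :
    CharpolyDivisible.{u, v, w} R (∑ i, n i) (∀ i, A i) S B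
        (fun s ↦ (γ (F s) ⟨s, rfl⟩).comp (Pi.evalAlgHom R A (F s))) ↔
      ∀ i, CharpolyDivisible.{u, v, w} R (n i) (A i) {s : S // F s = i} B (γ i) := by
  have hfib : ∀ (R' : Type (max u v w)) [CommRing R'] [Algebra R R'] (a : R' ⊗[R] (∀ i, A i)),
      ∏ s, (Polynomial.X - Polynomial.C (Algebra.TensorProduct.map (AlgHom.id R' R')
        ((γ (F s) ⟨s, rfl⟩).comp (Pi.evalAlgHom R A (F s))) a)) =
      ∏ i, ∏ s : {s : S // F s = i}, (Polynomial.X - Polynomial.C (Algebra.TensorProduct.map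
        (AlgHom.id R' R') (γ i s)
          (Algebra.TensorProduct.map (AlgHom.id R' R') (Pi.evalAlgHom R A i) a))) := by
    intro R' _ _ a
    rw [← Fintype.prod_fiberwise F]
    refine Finset.prod_congr rfl fun i _ ↦ Finset.prod_congr rfl fun s _ ↦ ?_
    obtain ⟨s, rfl⟩ := s
    congr 2
    induction a with
    | zero => simp
    | tmul x y => simp
    | add x y hx hy => simp only [map_add, hx, hy]
  constructor
  · intro H i R' _ _ a
    have key : ∀ c : R', ∃ N : ℕ,
        ∏ s, (Polynomial.X -
          Polynomial.C (Algebra.TensorProduct.map (AlgHom.id R' R') (γ i s) a)) ∣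
        (algCharpoly R' (n i) a).map (algebraMap R' (R' ⊗[R] B)) *
          (Polynomial.X - Polynomial.C (algebraMap R' (R' ⊗[R] B) c)) ^ N := by
      intro c
      obtain ⟨x, hx⟩ := (Algebra.TensorProduct.piRight R R' R' A).surjective
        (Function.update (fun j ↦ algebraMap R' (R' ⊗[R] A j) c) i a)
      have hx' : ∀ j, Algebra.TensorProduct.map (AlgHom.id R' R') (Pi.evalAlgHom R A j) x =
          Function.update (fun j ↦ algebraMap R' (R' ⊗[R] A j) c) i a j := fun j ↦ by
        rw [← piRight_apply, hx]
      have h := H R' x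
      rw [hfib, algCharpoly_tensor_pi hA, Polynomial.map_prod] at h
      replace h := (Finset.dvd_prod_of_mem _ (Finset.mem_univ i)).trans h
      simp only [hx'] at h
      rw [Function.update_self, ← Finset.mul_prod_erase _ _ (Finset.mem_univ i),
        Function.update_self] at h
      refine ⟨∑ j ∈ Finset.univ.erase i, n j, ?_⟩
      convert h using 2
      rw [← Finset.prod_pow_eq_pow_sum]
      refine Finset.prod_congr rfl fun j hj ↦ ?_
      rw [Function.update_of_ne (Finset.ne_of_mem_erase hj), algCharpoly_algebraMap fun p ↦ by
        rw [Module.rankAtStalk_baseChange, hA]]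
      simp
    -- `X - 0` and `X - 1` differ by a unit, hence their powers are coprime.
    obtain ⟨N₀, h₀⟩ := key 0
    obtain ⟨N₁, h₁⟩ := key 1
    have hco : IsCoprime ((Polynomial.X - Polynomial.C (algebraMap R' (R' ⊗[R] B) 0)) ^ N₀)
        ((Polynomial.X - Polynomial.C (algebraMap R' (R' ⊗[R] B) 1)) ^ N₁) :=
      IsCoprime.pow ⟨1, -1, by rw [map_zero, map_one, map_zero, map_one]; ring⟩
    obtain ⟨p, q, hpq⟩ := hco
    have := dvd_add (h₀.mul_left p) (h₁.mul_left q)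
    rwa [mul_left_comm p, mul_left_comm q, ← mul_add, hpq, mul_one] at this
  · intro H R' _ _ a
    rw [hfib, algCharpoly_tensor_pi hA, Polynomial.map_prod]
    exact Finset.prod_dvd_prod_of_dvd _ _ fun i _ ↦ H i R' _

end Divisibility

/-! ### Universality of the product -/

section Universality

variable {R : Type u} [CommRing R]

/-- A map out of a product which sends the idempotent of one factor to `1` factors through the
projection to that factor. -/
lemma exists_factor_eval {ι : Type*} [DecidableEq ι] {A : ι → Type*} [∀ i, CommRing (A i)]
    [∀ i, Algebra R (A i)] {B : Type*} [CommRing B] [Algebra R B] (h : (∀ i, A i) →ₐ[R] B) (i : ι)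
    (hi : h (Pi.single i 1) = 1) :
    ∃ γ : A i →ₐ[R] B, h = γ.comp (Pi.evalAlgHom R A i) := by
  refine ⟨AlgHom.ofLinearMap (h.toLinearMap ∘ₗ LinearMap.single R A i) hi fun x y ↦ ?_, ?_⟩
  · simp [← map_mul, Pi.single_mul]
  · ext a
    have : Pi.single i (a i) = a * Pi.single i 1 := by
      ext j
      obtain rfl | hj := eq_or_ne j i
      · simp
      · simp [hj]
    change h a = h (Pi.single i (a i))
    rw [this, map_mul, hi, mul_one]

variable {m : ℕ} {A : Fin m → Type v} [∀ i, CommRing (A i)] [∀ i, Algebra R (A i)]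
  {S : Type w}

lemma productMap_apply {E : (S → Fin m) → Fin m → Type*} [∀ F i, CommRing (E F i)]
    [∀ F i, Algebra R (E F i)]
    (α : ∀ (F : S → Fin m) (i : Fin m), {s : S // F s = i} → A i →ₐ[R] E F i) (s : S)
    (a : ∀ i, A i) (F : S → Fin m) :
    productMap α s a F = PiTensorProduct.singleAlgHom (F s) (α F (F s) ⟨s, rfl⟩ (a (F s))) := rfl

variable [Fintype S]

/-- For maps `β s` from `∏ i, A i` to `B`, the product over `s` of the images of the idempotents of
the factors `F s`. -/
def fibreIdempotent {B : Type*} [CommRing B] [Algebra R B] (β : S → (∀ i, A i) →ₐ[R] B)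
    (F : S → Fin m) : B :=
  ∏ s, β s (Pi.single (F s) 1)

lemma completeOrthogonalIdempotents_fibreIdempotent [Fintype (S → Fin m)] {B : Type*} [CommRing B]
    [Algebra R B] (β : S → (∀ i, A i) →ₐ[R] B) :
    CompleteOrthogonalIdempotents (fibreIdempotent β) where
  idem F := by
    rw [IsIdempotentElem, fibreIdempotent, ← Finset.prod_mul_distrib]
    refine Finset.prod_congr rfl fun s _ ↦ ?_
    rw [← map_mul, ← Pi.single_mul, one_mul]
  ortho F G hFG := by
    obtain ⟨s, hs⟩ := Function.ne_iff.mp hFG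
    rw [fibreIdempotent, fibreIdempotent, ← Finset.prod_mul_distrib]
    refine Finset.prod_eq_zero (Finset.mem_univ s) ?_
    rw [← map_mul, ← map_zero (β s)]
    congr 1
    ext j
    obtain rfl | hj := eq_or_ne j (F s)
    · simp [hs]
    · simp [hj]
  complete := by
    classical
    have : ∏ s, ∑ i, β s (Pi.single i 1) = 1 := by
      refine Finset.prod_eq_one fun s _ ↦ ?_
      rw [← map_sum, ← map_one (β s)]
      exact congrArg (β s) (Finset.univ_sum_single (1 : ∀ i, A i))
    rw [Finset.prod_univ_sum, Fintype.piFinset_univ] at this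
    rw [← this]
    exact Finset.sum_congr (by ext; simp) fun _ _ ↦ rfl

lemma fibreIdempotent_productMap [DecidableEq (S → Fin m)] {E : (S → Fin m) → Fin m → Type*}
    [∀ F i, CommRing (E F i)] [∀ F i, Algebra R (E F i)]
    (α : ∀ (F : S → Fin m) (i : Fin m), {s : S // F s = i} → A i →ₐ[R] E F i) (F : S → Fin m) :
    fibreIdempotent (productMap α) F = Pi.single F 1 := by
  ext G
  rw [fibreIdempotent, Finset.prod_apply]
  simp only [productMap_apply]
  obtain rfl | hG := eq_or_ne G F
  · rw [Pi.single_eq_same]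
    exact Finset.prod_eq_one fun s _ ↦ by rw [Pi.single_eq_same, map_one, map_one]
  · obtain ⟨s, hs⟩ := Function.ne_iff.mp hG
    rw [Pi.single_eq_of_ne hG]
    exact Finset.prod_eq_zero (Finset.mem_univ s) (by
      rw [Pi.single_eq_of_ne hs, map_zero, map_zero])

variable {n : Fin m → ℕ} [∀ i, Module.Finite R (A i)] [∀ i, Module.Projective R (A i)]

lemma isSClosure_productMap
    (hA : ∀ i (p : PrimeSpectrum R), Module.rankAtStalk (A i) p = n i)
    {E : (S → Fin m) → Fin m → Type (max u v w)} [∀ F i, CommRing (E F i)]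
    [∀ F i, Algebra R (E F i)]
    (α : ∀ (F : S → Fin m) (i : Fin m), {s : S // F s = i} → A i →ₐ[R] E F i)
    (hα : ∀ F i, IsSClosure.{u, v, w} R (n i) (A i) {s : S // F s = i} (E F i) (α F i)) :
    IsSClosure.{u, v, w} R (∑ i, n i) (∀ i, A i) S
      (∀ F : S → Fin m, ⨂[R] i, E F i) (productMap α) := by
  classical
  refine ⟨charpolyDivisible_pi fun F ↦ ?_, fun B _ _ β hβ ↦ ?_⟩
  · exact (charpolyDivisible_iff_fibres hA F
      fun i s ↦ (PiTensorProduct.singleAlgHom i).comp (α F i s)).mpr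
        fun i ↦ (hα F i).divisible.comp (PiTensorProduct.singleAlgHom i)
  -- The idempotents `e F` identify `B` with the product of its quotients by `1 - e F`.
  let e := fibreIdempotent β
  have he : CompleteOrthogonalIdempotents e := completeOrthogonalIdempotents_fibreIdempotent β
  let q : ∀ F, B →ₐ[R] B ⧸ Ideal.span {1 - e F} := fun F ↦ Ideal.Quotient.mkₐ R _
  let Q : B ≃ₐ[R] ∀ F, B ⧸ Ideal.span {1 - e F} := AlgEquiv.ofBijective (AlgHom.pi q)
    he.bijective_pi
  have hqe : ∀ F, q F (e F) = 1 := fun F ↦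
    (Ideal.Quotient.eq.mpr (Ideal.mem_span_singleton_self _)).symm
  have hfactor : ∀ F i (s : {s : S // F s = i}), ∃ γ : A i →ₐ[R] B ⧸ Ideal.span {1 - e F},
      (q F).comp (β s) = γ.comp (Pi.evalAlgHom R A i) := by
    rintro F _ ⟨s, rfl⟩
    refine exists_factor_eval _ _ ?_
    have : β s (Pi.single (F s) 1) * e F = e F := by
      change _ * ∏ s, _ = ∏ s, _
      rw [← Finset.mul_prod_erase _ _ (Finset.mem_univ s), ← mul_assoc, ← map_mul,
        ← Pi.single_mul, one_mul]
    simpa [hqe] using congrArg (q F) this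
  choose γ hγ using hfactor
  have hγ_div : ∀ F i, CharpolyDivisible.{u, v, w} R (n i) (A i) {s : S // F s = i} _ (γ F i) :=
    fun F ↦ (charpolyDivisible_iff_fibres hA F (γ F)).mp (by
      simp only [← hγ]
      exact hβ.comp (q F))
  choose φ hφ hφ_unique using fun F i ↦ (hα F i).universal _ (γ F i) (hγ_div F i)
  refine ⟨Q.symm.toAlgHom.comp
    (AlgHom.pi fun F ↦ (piTensorLift (φ F)).comp (Pi.evalAlgHom R _ F)), fun s ↦ ?_,
    fun ψ hψ ↦ ?_⟩
  · ext a
    refine Q.injective (funext fun F ↦ ?_)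
    have h₁ := DFunLike.congr_fun (piTensorLift_comp_single (φ F) (F s))
      (α F (F s) ⟨s, rfl⟩ (a (F s)))
    have h₂ := DFunLike.congr_fun (hφ F (F s) ⟨s, rfl⟩) (a (F s))
    have h₃ := DFunLike.congr_fun (hγ F (F s) ⟨s, rfl⟩) a
    refine (congrFun (Q.apply_symm_apply _) F).trans ?_
    exact h₁.trans (h₂.trans h₃.symm)
  -- A second map `ψ` sends the idempotent of the factor `F` to `e F`, so that modulo `1 - e F` it
  -- factors through `⨂ i, E F i`, where it is determined on each `E F i`.
  · have hψe : ∀ F, ψ (Pi.single F 1) = e F := fun F ↦ by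
      rw [← fibreIdempotent_productMap α F, fibreIdempotent, map_prod]
      exact Finset.prod_congr rfl fun s _ ↦ DFunLike.congr_fun (hψ s) _
    have hcomp : ∀ F, (q F).comp ψ = (piTensorLift (φ F)).comp (Pi.evalAlgHom R _ F) := by
      intro F
      obtain ⟨χ, hχ⟩ := exists_factor_eval ((q F).comp ψ) F (by
        rw [AlgHom.comp_apply, hψe, hqe])
      rw [hχ]
      congr 1
      refine PiTensorProduct.algHom_ext fun i ↦ ?_
      rw [piTensorLift_comp_single]
      refine hφ_unique F i _ fun s ↦ ?_
      obtain ⟨s, rfl⟩ := s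
      ext a
      have h₁ := DFunLike.congr_fun hχ (productMap α s (Pi.single (F s) a))
      have h₂ := DFunLike.congr_fun (hψ s) (Pi.single (F s) a)
      have h₃ := DFunLike.congr_fun (hγ F (F s) ⟨s, rfl⟩) (Pi.single (F s) a)
      simp only [AlgHom.comp_apply, Pi.evalAlgHom_apply, productMap_apply,
        Pi.single_eq_same] at h₁ h₂ h₃ ⊢
      rw [← h₁, h₂, h₃]
    ext x
    refine Q.injective (funext fun F ↦ ?_)
    refine (DFunLike.congr_fun (hcomp F) x).trans ?_
    exact (congrFun (Q.apply_symm_apply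
      fun F ↦ piTensorLift (φ F) (x F)) F).symm

end Universality

end SClosure

end

theorem mainTheorem2 {R : Type u} [CommRing R] {m : ℕ} (hm : 0 < m) (n : Fin m → ℕ)
    (A : Fin m → Type v) [∀ i, CommRing (A i)] [∀ i, Algebra R (A i)]
    [∀ i, Module.Finite R (A i)] [∀ i, Module.Projective R (A i)]
    (hA : ∀ i (p : PrimeSpectrum R), Module.rankAtStalk (A i) p = n i)
    (S : Type w) [Fintype S] :
    (∀ p : PrimeSpectrum R, Module.rankAtStalk (∀ i, A i) p = ∑ i, n i) ∧
    (∀ (F : S → Fin m) (i : Fin m), ∃ (E : Type (max u v w)) (_ : CommRing E) (_ : Algebra R E)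
      (α : {s : S // F s = i} → A i →ₐ[R] E),
      SClosure.IsSClosure.{u, v, w} R (n i) (A i) {s : S // F s = i} E α) ∧
    ∀ (E : (S → Fin m) → Fin m → Type (max u v w))
      [∀ F i, CommRing (E F i)] [∀ F i, Algebra R (E F i)]
      (α : ∀ (F : S → Fin m) (i : Fin m), {s : S // F s = i} → A i →ₐ[R] E F i),
      (∀ F i, SClosure.IsSClosure.{u, v, w} R (n i) (A i) {s : S // F s = i} (E F i) (α F i)) →
      SClosure.IsSClosure.{u, v, w} R (∑ i, n i) (∀ i, A i) S
        (∀ F : S → Fin m, ⨂[R] i, E F i) (SClosure.productMap α) :=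
  ⟨fun p ↦ by simp [Module.rankAtStalk_pi, hA, finsum_eq_sum_of_fintype],
    fun F i ↦ SClosure.exists_isSClosure (n i) (A i) {s : S // F s = i},
    fun _ _ _ α hα ↦ SClosure.isSClosure_productMap hA α hα⟩
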